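/- Let $n,k,\ell,d,r$ be natural numbers with $0\le r\le n-1$, and let $A$ be an $\ell\times k$ matrix whose entries are homogeneous polynomials of the same degree $d$ in $\mathbb{C}[\partial_1,\dots,\partial_n]$. Polynomials act on distributions by $\partial_s=\partial/\partial x_s$, and a vector $\phi=(\phi_1,\dots,\phi_k)$ of distributions in $\mathcal{D}'(\mathbb{R}^n,\mathbb{C})$ is a solution to $A$ if $\sum_{j=1}^k a_{ij}(\partial)\,\phi_j=0$ for $i=1,\dots,\ell$. For $y\in\mathbb{R}^n$ let $A(y)\in\mathbb{C}^{\ell\times k}$ be the matrix obtained by substituting $y_s$ for $\partial_s$, and define the real wave cone $$\mathcal{W}^r_{A,\mathbb{R}}\;=\;\bigcup_{\pi\in\mathrm{Gr}_{\mathbb{R}}(n-r,n)}\ \bigcap_{y\in\pi\setminus\{0\}}\ker A(y)\;\subseteq\;\mathbb{C}^k ,$$ where $\mathrm{Gr}_{\mathbb{R}}(n-r,n)$ is the set of $(n-r)$-dimensional linear subspaces of $\mathbb{R}^n$. For a real $(n-r)\times n$ matrix $L$ of rank $n-r$ and a distribution $\delta\in\mathcal{D}'(\mathbb{R}^{n-r},\mathbb{C})$,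 let $\delta(Lx)$ be the distribution on $\mathbb{R}^n$ that maps a test function $f$ to $\delta(f_L)$, where $f_L$ is the test function $$f_L(y)=\frac{1}{\sqrt{\det(LL^T)}}\int_{\ker L} f\bigl(L^T(LL^T)^{-1}y+w\bigr)\,dw\qquad(y\in\mathbb{R}^{n-r})$$ and $dw$ is the Lebesgue measure of the Euclidean space $\ker L$; for a continuous function $\delta$ this is the ordinary composition $x\mapsto\delta(Lx)$. Then a vector $u\in\mathbb{C}^k$ lies in $\mathcal{W}^r_{A,\mathbb{R}}$ if and only if there is a matrix $L\in\mathbb{R}^{(n-r)\times n}$ of rank $n-r$ such that $x\mapsto\delta(Lx)\cdot u$ is a solution to $A$ for all distributions $\delta\in\mathcal{D}'(\mathbb{R}^{n-r},\mathbb{C})$. -/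

import Mathlib

open scoped Distributions ContDiff Matrix
open TopologicalSpace MeasureTheory

noncomputable section

namespace WaveCone

/-! ### Integration over the fibres of a linear map -/

section FiberIntegral

variable {E G N : Type} [NormedAddCommGroup E] [NormedSpace ℝ E]
  [NormedAddCommGroup G] [NormedSpace ℝ G] [NormedAddCommGroup N] [NormedSpace ℝ N]
  [MeasurableSpace N]

/-- `fiberIntegral s i μ f y = ∫ f (s y + i w) dμ(w)`. -/
def fiberIntegral {F : Type} [NormedAddCommGroup F] [NormedSpace ℝ F]
    (s : G →L[ℝ] E) (i : N →L[ℝ] E) (μ : Measure N) (f : E → F) (y : G) : F :=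
  ∫ w, f (s y + i w) ∂μ

variable [BorelSpace N] {s : G →L[ℝ] E} {i : N →L[ℝ] E}
  {μ : Measure N} [IsFiniteMeasureOnCompacts μ] {K : Set E} {k : Set N}

theorem fiberIntegral_integrable {F : Type} [NormedAddCommGroup F] [NormedSpace ℝ F]
    (hk : IsCompact k) (hKk : ∀ y w, s y + i w ∈ K → w ∈ k)
    {f : E → F} (hf : Continuous f) (hfK : tsupport f ⊆ K) (y : G) :
    Integrable (fun w => f (s y + i w)) μ := by
  have hc : Continuous fun w => f (s y + i w) := by fun_prop
  refine hc.integrable_of_hasCompactSupport (HasCompactSupport.intro hk ?_)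
  intro w hw
  by_contra h
  exact hw (hKk y w (hfK (subset_tsupport f h)))

variable [SecondCountableTopology N]

theorem fiberIntegral_hasFDerivAt {F : Type} [NormedAddCommGroup F] [NormedSpace ℝ F]
    (hK : IsCompact K) (hk : IsCompact k) (hKk : ∀ y w, s y + i w ∈ K → w ∈ k)
    {f : E → F} (hf : ContDiff ℝ 1 f) (hfK : tsupport f ⊆ K) (y : G) :
    HasFDerivAt (fiberIntegral s i μ f)
      (fiberIntegral s i μ (fun x => (fderiv ℝ f x).comp s) y) y := by
  have hd : Continuous (fderiv ℝ f) := hf.continuous_fderiv (by norm_num)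
  have hfs : HasCompactSupport f := hK.of_isClosed_subset (isClosed_tsupport f) hfK
  obtain ⟨C, hC⟩ := (hfs.fderiv (𝕜 := ℝ)).exists_bound_of_continuous hd
  have hz : ∀ x, x ∉ K → fderiv ℝ f x = 0 := fun x hx => by
    by_contra h
    exact hx (hfK (support_fderiv_subset ℝ h))
  refine hasFDerivAt_integral_of_dominated_of_fderiv_le (s := Set.univ)
    (F := fun y w => f (s y + i w)) (F' := fun y w => (fderiv ℝ f (s y + i w)).comp s)
    (bound := k.indicator fun _ => C * ‖s‖) Filter.univ_mem ?_ ?_ ?_ ?_ ?_ ?_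
  · have := hf.continuous
    exact .of_forall fun y => Continuous.aestronglyMeasurable (by fun_prop)
  · exact fiberIntegral_integrable hk hKk hf.continuous hfK y
  · exact Continuous.aestronglyMeasurable (by fun_prop)
  · refine .of_forall fun w y _ => ?_
    by_cases hw : w ∈ k
    · rw [Set.indicator_of_mem hw]
      exact (ContinuousLinearMap.opNorm_comp_le _ _).trans
        (mul_le_mul_of_nonneg_right (hC _) (norm_nonneg _))
    · rw [Set.indicator_of_notMem hw, hz _ fun h => hw (hKk y w h)]
      simp
  · exact (integrable_indicator_iff hk.measurableSet).2
      (integrableOn_const hk.measure_lt_top.ne)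
  · refine .of_forall fun w y _ => ?_
    have h1 : HasFDerivAt f (fderiv ℝ f (s y + i w)) (s y + i w) :=
      (hf.differentiable (by norm_num)).differentiableAt.hasFDerivAt
    exact h1.comp y (s.hasFDerivAt.add_const _)

theorem tsupport_fderiv_comp_subset {F : Type} [NormedAddCommGroup F] [NormedSpace ℝ F]
    {f : E → F} (hfK : tsupport f ⊆ K) :
    tsupport (fun x => (fderiv ℝ f x).comp s) ⊆ K := by
  refine (closure_mono fun x hx => ?_).trans ((tsupport_fderiv_subset ℝ (f := f)).trans hfK)
  intro h
  exact hx (by simp [h])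

theorem fiberIntegral_contDiff (hK : IsCompact K) (hk : IsCompact k)
    (hKk : ∀ y w, s y + i w ∈ K → w ∈ k) (m : ℕ) :
    ∀ {F : Type} [NormedAddCommGroup F] [NormedSpace ℝ F] {f : E → F},
      ContDiff ℝ ∞ f → tsupport f ⊆ K → ContDiff ℝ m (fiberIntegral s i μ f) := by
  induction m with
  | zero =>
    intro F _ _ f hf hfK
    have hf1 : ContDiff ℝ 1 f := hf.of_le (by exact_mod_cast le_top)
    refine contDiff_zero.2 (continuous_iff_continuousAt.2 fun y => ?_)
    exact (fiberIntegral_hasFDerivAt hK hk hKk hf1 hfK y).continuousAt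
  | succ m ih =>
    intro F _ _ f hf hfK
    have hf1 : ContDiff ℝ 1 f := hf.of_le (by exact_mod_cast le_top)
    have hD := fiberIntegral_hasFDerivAt (μ := μ) hK hk hKk hf1 hfK
    have hfd : ContDiff ℝ ∞ (fun x => (fderiv ℝ f x).comp s) :=
      (contDiff_infty_iff_fderiv.1 hf).2.clm_comp contDiff_const
    push_cast
    refine contDiff_succ_iff_fderiv.2 ⟨fun y => (hD y).differentiableAt, by simp, ?_⟩
    rw [funext fun y => (hD y).fderiv]
    exact ih hfd (tsupport_fderiv_comp_subset hfK)

theorem fiberIntegral_norm_iteratedFDeriv_le (hK : IsCompact K) (hk : IsCompact k)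
    (hKk : ∀ y w, s y + i w ∈ K → w ∈ k) (m : ℕ) :
    ∀ {F : Type} [NormedAddCommGroup F] [NormedSpace ℝ F] {f : E → F},
      ContDiff ℝ ∞ f → tsupport f ⊆ K → ∀ C : ℝ, (∀ x, ‖iteratedFDeriv ℝ m f x‖ ≤ C) →
      ∀ y, ‖iteratedFDeriv ℝ m (fiberIntegral s i μ f) y‖ ≤ ‖s‖ ^ m * C * μ.real k := by
  induction m with
  | zero =>
    intro F _ _ f hf hfK C hC y
    have hz : ∀ w, w ∉ k → f (s y + i w) = 0 := fun w hw => by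
      by_contra h
      exact hw (hKk y w (hfK (subset_tsupport f h)))
    simp only [norm_iteratedFDeriv_zero] at hC ⊢
    rw [fiberIntegral, ← setIntegral_eq_integral_of_forall_compl_eq_zero hz, pow_zero, one_mul]
    exact norm_setIntegral_le_of_norm_le_const hk.measure_lt_top fun w _ => hC _
  | succ m ih =>
    intro F _ _ f hf hfK C hC y
    have hf1 : ContDiff ℝ 1 f := hf.of_le (by exact_mod_cast le_top)
    have hD := fiberIntegral_hasFDerivAt (μ := μ) hK hk hKk hf1 hfK
    have hf' : ContDiff ℝ ∞ (fderiv ℝ f) := (contDiff_infty_iff_fderiv.1 hf).2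
    have hfd : ContDiff ℝ ∞ (fun x => (fderiv ℝ f x).comp s) := hf'.clm_comp contDiff_const
    rw [← norm_iteratedFDeriv_fderiv, funext fun y => (hD y).fderiv]
    have := ih hfd (tsupport_fderiv_comp_subset hfK) (‖s‖ * C) (fun x => ?_) y
    · refine this.trans_eq (by ring)
    · let Λ : (E →L[ℝ] F) →L[ℝ] (G →L[ℝ] F) := (ContinuousLinearMap.compL ℝ G E F).flip s
      have hΛ : ‖Λ‖ ≤ ‖s‖ := by
        refine ContinuousLinearMap.opNorm_le_bound _ (norm_nonneg _) fun T => ?_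
        rw [mul_comm]
        exact ContinuousLinearMap.opNorm_comp_le T s
      have h1 := Λ.norm_iteratedFDeriv_comp_left (f := fderiv ℝ f) (x := x) (N := ∞) (n := m)
        hf'.contDiffAt (by exact_mod_cast le_top)
      rw [norm_iteratedFDeriv_fderiv] at h1
      exact h1.trans (mul_le_mul hΛ (hC x) (norm_nonneg _) (norm_nonneg _))

end FiberIntegral

/-! ### Composition of a distribution with a surjective linear map -/

/-- `ℝⁿ` with the Euclidean norm. -/
abbrev Rn (n : ℕ) : Type := EuclideanSpace ℝ (Fin n)

/-- The space `𝓓'(ℝⁿ, ℂ)` of complex-valued distributions on `ℝⁿ`. As always in Mathlib, they are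
continuous `ℝ`-linear maps to `ℂ` on real test functions; extension by `ℂ`-linearity to complex test
functions identifies them with the usual complex distributions. -/
abbrev Distr (n : ℕ) : Type := 𝓓'((⊤ : Opens (Rn n)), ℂ)

/-- Real test functions on `ℝⁿ`. -/
abbrev Test (n : ℕ) : Type := 𝓓((⊤ : Opens (Rn n)), ℝ)

section Pullback

variable {m n : ℕ}

/-- The linear map `x ↦ L x` from `ℝⁿ` to `ℝᵐ`. -/
def linMap (L : Matrix (Fin m) (Fin n) ℝ) : Rn n →L[ℝ] Rn m :=
  (Matrix.toEuclideanLin L).toContinuousLinearMap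

/-- The kernel of `L`, a Euclidean subspace of `ℝⁿ`. -/
abbrev kerOf (L : Matrix (Fin m) (Fin n) ℝ) : Submodule ℝ (Rn n) :=
  LinearMap.ker (Matrix.toEuclideanLin L)

/-- The right inverse `Lᵀ (L Lᵀ)⁻¹` of a matrix `L` of full row rank, as a linear map. -/
def rightInv (L : Matrix (Fin m) (Fin n) ℝ) : Rn m →L[ℝ] Rn n :=
  linMap (Lᵀ * (L * Lᵀ)⁻¹)

/-- For a test function `f` on `ℝⁿ`, the function
`y ↦ det (L Lᵀ) ^ (-1/2) * ∫_{w ∈ ker L} f (Lᵀ (L Lᵀ)⁻¹ y + w) dw` on `ℝᵐ`, where `dw` is the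
Lebesgue measure of the Euclidean space `ker L`. -/
def pushFun (L : Matrix (Fin m) (Fin n) ℝ) (f : Rn n → ℝ) (y : Rn m) : ℝ :=
  (√(L * Lᵀ).det)⁻¹ * fiberIntegral (rightInv L) (kerOf L).subtypeL volume f y

theorem linMap_rightInv {L : Matrix (Fin m) (Fin n) ℝ} (hL : L.rank = m) (y : Rn m) :
    linMap L (rightInv L y) = y := by
  have h1 : IsUnit (L * Lᵀ) := by
    rw [← Matrix.linearIndependent_rows_iff_isUnit, linearIndependent_iff_card_eq_finrank_span,
      Set.finrank, ← Matrix.rank_eq_finrank_span_row, Matrix.rank_self_mul_transpose, hL,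
      Fintype.card_fin]
  have h2 : L * (Lᵀ * (L * Lᵀ)⁻¹) = 1 := by
    rw [← Matrix.mul_assoc, Matrix.mul_nonsing_inv _ ((Matrix.isUnit_iff_isUnit_det _).1 h1)]
  ext j
  simp [rightInv, linMap, h2]

theorem linMap_ker {L : Matrix (Fin m) (Fin n) ℝ} (w : kerOf L) : linMap L w = 0 :=
  LinearMap.mem_ker.1 w.2

theorem exists_compact_fiber {L : Matrix (Fin m) (Fin n) ℝ} (hL : L.rank = m)
    {K : Set (Rn n)} (hK : IsCompact K) :
    ∃ k : Set (kerOf L), IsCompact k ∧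
      ∀ y w, rightInv L y + (kerOf L).subtypeL w ∈ K → w ∈ k := by
  let q : Rn n → Rn n := fun x => x - rightInv L (linMap L x)
  have hq : Continuous q := by fun_prop
  refine ⟨Subtype.val ⁻¹' (q '' K), ?_, fun y w h => ⟨_, h, ?_⟩⟩
  · exact (Submodule.closed_of_finiteDimensional (kerOf L)).isClosedEmbedding_subtypeVal
      |>.isCompact_preimage (hK.image hq)
  · simp only [q, Submodule.subtypeL_apply, map_add, linMap_rightInv hL, linMap_ker]
    simp

theorem pushFun_eqOn {L : Matrix (Fin m) (Fin n) ℝ} (hL : L.rank = m)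
    {K : Set (Rn n)} {f : Rn n → ℝ} (hf : tsupport f ⊆ K) :
    Set.EqOn (pushFun L f) 0 (linMap L '' K)ᶜ := by
  intro y hy
  have : ∀ w : kerOf L, f (rightInv L y + (kerOf L).subtypeL w) = 0 := fun w => by
    by_contra h
    refine hy ⟨_, hf (subset_tsupport f h), ?_⟩
    simp [linMap_rightInv hL, linMap_ker]
  simp only [pushFun, fiberIntegral, this, integral_zero, mul_zero, Pi.zero_apply]

theorem pushFun_contDiff {L : Matrix (Fin m) (Fin n) ℝ} (hL : L.rank = m)
    {f : Rn n → ℝ} (hf : ContDiff ℝ ∞ f) (hfs : HasCompactSupport f) :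
    ContDiff ℝ ∞ (pushFun L f) := by
  obtain ⟨k, hk, hKk⟩ := exists_compact_fiber hL hfs
  exact contDiff_const.mul (contDiff_infty.2 fun r => fiberIntegral_contDiff hfs hk hKk r hf le_rfl)

theorem pushFun_integrable {L : Matrix (Fin m) (Fin n) ℝ} (hL : L.rank = m)
    {f : Rn n → ℝ} (hf : Continuous f) (hfs : HasCompactSupport f) (y : Rn m) :
    Integrable (fun w : kerOf L => f (rightInv L y + (kerOf L).subtypeL w)) volume := by
  obtain ⟨k, hk, hKk⟩ := exists_compact_fiber hL hfs
  exact fiberIntegral_integrable hk hKk hf le_rfl y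

theorem pushFun_add {L : Matrix (Fin m) (Fin n) ℝ} (hL : L.rank = m)
    {f g : Rn n → ℝ} (hf : Continuous f) (hfs : HasCompactSupport f)
    (hg : Continuous g) (hgs : HasCompactSupport g) (y : Rn m) :
    pushFun L (fun x => f x + g x) y = pushFun L f y + pushFun L g y := by
  simp only [pushFun, fiberIntegral]
  rw [integral_add (pushFun_integrable hL hf hfs y) (pushFun_integrable hL hg hgs y), mul_add]

theorem pushFun_smul (L : Matrix (Fin m) (Fin n) ℝ) (c : ℝ) (f : Rn n → ℝ) (y : Rn m) :
    pushFun L (fun x => c * f x) y = c * pushFun L f y := by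
  simp only [pushFun, fiberIntegral]
  rw [integral_const_mul]
  ring

theorem pushFun_bound {L : Matrix (Fin m) (Fin n) ℝ} (hL : L.rank = m) (K : Compacts (Rn n))
    (r : ℕ) : ∃ C : ℝ, 0 ≤ C ∧ ∀ f : Rn n → ℝ, ContDiff ℝ ∞ f → tsupport f ⊆ K →
      ∀ M : ℝ, (∀ x, ‖iteratedFDeriv ℝ r f x‖ ≤ M) →
      ∀ y, ‖iteratedFDeriv ℝ r (pushFun L f) y‖ ≤ C * M := by
  obtain ⟨k, hk, hKk⟩ := exists_compact_fiber hL K.isCompact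
  refine ⟨(√(L * Lᵀ).det)⁻¹ * (‖rightInv L‖ ^ r * (volume : Measure (kerOf L)).real k),
    by positivity, fun f hf hfK M hM y => ?_⟩
  have h := fiberIntegral_norm_iteratedFDeriv_le (μ := (volume : Measure (kerOf L)))
    K.isCompact hk hKk r hf hfK M hM y
  have hc := fiberIntegral_contDiff (μ := (volume : Measure (kerOf L)))
    K.isCompact hk hKk r hf hfK
  have he : pushFun L f = (√(L * Lᵀ).det)⁻¹ •
      fiberIntegral (rightInv L) (kerOf L).subtypeL volume f := rfl
  rw [he, iteratedFDeriv_const_smul_apply hc.contDiffAt, norm_smul,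
    Real.norm_of_nonneg (by positivity), mul_assoc]
  exact mul_le_mul_of_nonneg_left (h.trans_eq (by ring)) (by positivity)

/-- `pushFun` between spaces of test functions with support in a fixed compact set. -/
def pushSupportedIn (L : Matrix (Fin m) (Fin n) ℝ) (hL : L.rank = m) (K : Compacts (Rn n)) :
    𝓓_{K}(Rn n, ℝ) →L[ℝ] 𝓓_{K.map (linMap L) (linMap L).continuous}(Rn m, ℝ) :=
  let Φ : 𝓓_{K}(Rn n, ℝ) →ₗ[ℝ] 𝓓_{K.map (linMap L) (linMap L).continuous}(Rn m, ℝ) :=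
    { toFun f := ⟨pushFun L f, pushFun_contDiff hL f.contDiff f.hasCompactSupport,
        pushFun_eqOn hL f.tsupport_subset⟩
      map_add' f g := by
        ext y
        exact pushFun_add hL f.continuous f.hasCompactSupport g.continuous g.hasCompactSupport y
      map_smul' c f := by
        ext y
        exact pushFun_smul L c f y }
  { toLinearMap := Φ
    cont := by
      refine WithSeminorms.continuous_of_isBounded (ContDiffMapSupportedIn.withSeminorms ℝ _ _ _ _)
        (ContDiffMapSupportedIn.withSeminorms ℝ _ _ _ _) Φ (.of_real fun r => ?_)
      obtain ⟨C, hC, h⟩ := pushFun_bound hL K r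
      refine ⟨{r}, C, fun f => ?_⟩
      rw [Finset.sup_singleton]
      exact ((Φ f).seminorm_top_le_iff ℝ (mul_nonneg hC (apply_nonneg _ _)) r).2 fun y _ =>
        h f f.contDiff f.tsupport_subset _
          (fun x => ContDiffMapSupportedIn.norm_iteratedFDeriv_apply_le_seminorm_top ℝ) y }

/-- The continuous linear map `f ↦ pushFun L f` from test functions on `ℝⁿ` to test functions
on `ℝᵐ`, for a matrix `L` of full row rank `m`. -/
def pushTest (L : Matrix (Fin m) (Fin n) ℝ) (hL : L.rank = m) : Test n →L[ℝ] Test m :=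
  TestFunction.limitCLM ℝ
    (fun f => ⟨pushFun L f, pushFun_contDiff hL f.contDiff f.hasCompactSupport,
      HasCompactSupport.intro (f.hasCompactSupport.isCompact.image (linMap L).continuous)
        (fun _ hy => pushFun_eqOn hL le_rfl hy), fun _ _ => trivial⟩)
    (fun K _ => (TestFunction.ofSupportedInCLM ℝ (Ω := ⊤) (fun _ _ => trivial)).comp
      (pushSupportedIn L hL K))
    (fun _ _ _ => by ext; rfl)

/-- The composition `x ↦ δ(L x)` of a distribution `δ` on `ℝᵐ` with a linear map `L : ℝⁿ → ℝᵐ` of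
rank `m`: the distribution `f ↦ δ (pushFun L f)` on `ℝⁿ`. -/
def pullback (L : Matrix (Fin m) (Fin n) ℝ) (hL : L.rank = m) (δ : Distr m) : Distr n :=
  (pushTest L hL).precompCompactConvergenceCLM ℂ δ

theorem pullback_apply (L : Matrix (Fin m) (Fin n) ℝ) (hL : L.rank = m) (δ : Distr m)
    (f : Test n) : pullback L hL δ f = δ (pushTest L hL f) := rfl

theorem pushTest_apply (L : Matrix (Fin m) (Fin n) ℝ) (hL : L.rank = m) (f : Test n) (y : Rn m) :
    pushTest L hL f y = pushFun L f y := rfl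

end Pullback

/-! ### Constant coefficient operators, their solutions and their wave cones -/

variable {n k l : ℕ}

/-- The partial derivative `∂ T / ∂ x_s` of a distribution. -/
def partialDeriv (s : Fin n) (T : Distr n) : Distr n :=
  Distribution.lineDerivCLM (EuclideanSpace.single s (1 : ℝ)) T

/-- The derivative `∂₁^{α₁} ⋯ ∂ₙ^{αₙ} T` of a distribution. -/
def multiDeriv (α : Fin n →₀ ℕ) (T : Distr n) : Distr n :=
  (List.finRange n).foldr (fun s S => (partialDeriv s)^[α s] S) T

/-- The action `p(∂) • T` of a polynomial `p ∈ ℂ[∂₁, …, ∂ₙ]` on a distribution. -/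
def polyAct (p : MvPolynomial (Fin n) ℂ) (T : Distr n) : Distr n :=
  ∑ α ∈ p.support, p.coeff α • multiDeriv α T

/-- The vector-valued distribution `φ : ℝⁿ → ℂᵏ` solves the system `A • φ = 0`. -/
def IsSolution (A : Matrix (Fin l) (Fin k) (MvPolynomial (Fin n) ℂ)) (φ : Fin k → Distr n) : Prop :=
  ∀ i, ∑ j, polyAct (A i j) (φ j) = 0

/-- The complex matrix `A(y)`, for `y ∈ ℝⁿ`. -/
def evalAt (A : Matrix (Fin l) (Fin k) (MvPolynomial (Fin n) ℂ)) (y : Rn n) :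
    Matrix (Fin l) (Fin k) ℂ :=
  A.map (MvPolynomial.eval fun s => (y s : ℂ))

/-- The level `r` real wave cone: the union, over all real subspaces `π ⊆ ℝⁿ` of dimension `n - r`,
of the intersections of the kernels of `A(y)` in `ℂᵏ` over all `y ∈ π \ {0}`. -/
def realWaveCone (A : Matrix (Fin l) (Fin k) (MvPolynomial (Fin n) ℂ)) (r : ℕ) :
    Set (Fin k → ℂ) :=
  ⋃ (π : Submodule ℝ (Rn n)) (_ : Module.finrank ℝ π = n - r),
    ⋂ (y : Rn n) (_ : y ∈ π ∧ y ≠ 0), {u | evalAt A y *ᵥ u = 0}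

end WaveCone

end

/-!
By the chain rule `∂_v (δ(L x)) = (∂_{L v} δ)(L x)`, a polynomial operator `p(∂)` acts on `δ(L x)`
as `q(∂)` acts on `δ`, where `q(z) = p(Lᵀ z)`. Take for `p` an entry of `A u`. The distribution
given by `exp ⟨z, ·⟩` is an eigenvector of `q(∂)` with eigenvalue `q(z)` and its composition with
`L` does not vanish, so if every `δ(L x) u` is a solution, then `A(Lᵀ z) u = 0` for all `z`.
Conversely, if `A(y) u = 0` for all nonzero `y` in the row space of `L`, then `q` vanishes at all
nonzero real points, hence is the zero polynomial. The row spaces of the matrices of rank `n - r`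
are exactly the subspaces over which the wave cone is a union.
-/

noncomputable section

namespace WaveCone

/-! ### Polynomials and matrices -/

theorem eq_zero_of_eval_algebraMap_eq_zero {σ R S : Type*} [Nonempty σ] [CommRing R] [Infinite R]
    [CommRing S] [IsDomain S] [Algebra R S] [FaithfulSMul R S] {p : MvPolynomial σ S}
    (h : ∀ z : σ → R, z ≠ 0 → MvPolynomial.eval (fun i => algebraMap R S (z i)) p = 0) :
    p = 0 := by
  have hinf : (algebraMap R S '' {0}ᶜ).Infinite :=
    (Set.finite_singleton 0).infinite_compl.image
      (FaithfulSMul.algebraMap_injective R S).injOn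
  refine MvPolynomial.funext_set _ (fun _ => hinf) fun x hx => ?_
  choose z hz hzx using fun i => hx i (Set.mem_univ i)
  obtain rfl : (fun i => algebraMap R S (z i)) = x := funext hzx
  obtain ⟨i⟩ := ‹Nonempty σ›
  rw [h z fun hz0 => hz i (congrFun hz0 i), map_zero]

theorem vecMul_injective_of_rank_eq_card {K ι κ : Type*} [Field K] [Fintype ι] [Fintype κ]
    {M : Matrix ι κ K} (hM : M.rank = Fintype.card ι) : Function.Injective M.vecMul := by
  rw [Matrix.vecMul_injective_iff, linearIndependent_iff_card_eq_finrank_span, Set.finrank,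
    ← Matrix.rank_eq_finrank_span_row, hM]

theorem det_mul_transpose_pos {ι κ : Type*} [Fintype ι] [DecidableEq ι] [Fintype κ]
    {M : Matrix ι κ ℝ} (hM : M.rank = Fintype.card ι) : 0 < (M * Mᵀ).det := by
  rw [← Matrix.conjTranspose_eq_transpose_of_trivial]
  exact (Matrix.PosDef.mul_conjTranspose_self M (vecMul_injective_of_rank_eq_card hM)).det_pos

theorem prod_map_pow_add_of_commute {ι M : Type*} [Monoid M] {f : ι → M}
    (hf : ∀ i j, Commute (f i) (f j)) (a b : ι → ℕ) (l : List ι) :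
    (l.map fun i => f i ^ (a i + b i)).prod =
      (l.map fun i => f i ^ a i).prod * (l.map fun i => f i ^ b i).prod := by
  induction l with
  | nil => simp
  | cons i l ih =>
    have hcomm : Commute (f i ^ b i) (l.map fun i => f i ^ a i).prod := by
      refine Commute.list_prod_right _ _ fun x hx => ?_
      obtain ⟨j, -, rfl⟩ := List.mem_map.1 hx
      exact (hf i j).pow_pow _ _
    simp only [List.map_cons, List.prod_cons, ih]
    rw [pow_add, mul_assoc, mul_assoc, hcomm.left_comm]

section RowSpace

variable {m n : ℕ}

/-- The row space of a real matrix `L`, as a subspace of Euclidean space: the range of `Lᵀ`. -/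
def rowSpace (L : Matrix (Fin m) (Fin n) ℝ) : Submodule ℝ (Rn n) :=
  (Matrix.toEuclideanLin Lᵀ).range

theorem finrank_rowSpace (L : Matrix (Fin m) (Fin n) ℝ) :
    Module.finrank ℝ (rowSpace L) = L.rank := by
  rw [← Matrix.rank_transpose]
  exact (Matrix.rank_eq_finrank_range_toLin Lᵀ (PiLp.basisFun 2 ℝ _) (PiLp.basisFun 2 ℝ _)).symm

theorem exists_rowSpace_eq {π : Submodule ℝ (Rn n)} (hπ : Module.finrank ℝ π = m) :
    ∃ L : Matrix (Fin m) (Fin n) ℝ, rowSpace L = π := by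
  let e : Rn m ≃ₗ[ℝ] π := LinearEquiv.ofFinrankEq _ _ (by simp [hπ])
  refine ⟨(Matrix.toEuclideanLin.symm (π.subtype ∘ₗ e.toLinearMap))ᵀ, ?_⟩
  simp [rowSpace, LinearMap.range_comp]

theorem linMap_transpose_injective {L : Matrix (Fin m) (Fin n) ℝ} (hL : L.rank = m) :
    Function.Injective (linMap Lᵀ) := by
  intro x y hxy
  have hvec : L.vecMul x = L.vecMul y := by
    rw [← Matrix.mulVec_transpose, ← Matrix.mulVec_transpose]
    exact congr(WithLp.ofLp $hxy)
  exact WithLp.ofLp_injective 2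
    (vecMul_injective_of_rank_eq_card (hL.trans (Fintype.card_fin m).symm) hvec)

theorem inner_linMap_left (L : Matrix (Fin m) (Fin n) ℝ) (x : Rn n) (y : Rn m) :
    inner ℝ (linMap L x) y = inner ℝ x (linMap Lᵀ y) := by
  rw [← Matrix.conjTranspose_eq_transpose_of_trivial]
  simp only [linMap, LinearMap.coe_toContinuousLinearMap',
    Matrix.toEuclideanLin_conjTranspose_eq_adjoint, LinearMap.adjoint_inner_right]

end RowSpace

/-! ### Directional derivatives of distributions -/

open LineDeriv

section LineDeriv

variable {E F : Type*} [NormedAddCommGroup E] [NormedSpace ℝ E] [NormedAddCommGroup F]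
  [NormedSpace ℝ F] {Ω : Opens E}

theorem lineDerivOp_testFunction_apply (v : E) (f : 𝓓(Ω, F)) (x : E) :
    (∂_{v} f) x = fderiv ℝ f x v := by
  rw [TestFunction.lineDerivOp_eq_lineDerivCLM ℝ,
    TestFunction.lineDerivCLM_apply_of_le (by simp),
    (f.contDiff.differentiable (by simp) x).lineDeriv_eq_fderiv]

theorem lineDerivOp_testFunction_comm (v w : E) (f : 𝓓(Ω, F)) :
    ∂_{v} (∂_{w} f) = ∂_{w} (∂_{v} f) := by
  have hf' : Differentiable ℝ (fderiv ℝ f) :=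
    (contDiff_infty_iff_fderiv.1 f.contDiff).2.differentiable (by simp)
  have hsecond (a b x : E) : (∂_{a} (∂_{b} f)) x = fderiv ℝ (fderiv ℝ f) x a b := by
    rw [lineDerivOp_testFunction_apply, funext (lineDerivOp_testFunction_apply b f),
      fderiv_clm_apply (hf' x) (differentiableAt_const b)]
    simp
  ext x
  rw [hsecond, hsecond]
  refine (f.contDiff.contDiffAt.isSymmSndFDerivAt ?_).eq v w
  rw [minSmoothness_of_isRCLikeNormedField]
  exact WithTop.coe_le_coe.2 (le_top : (2 : ℕ∞) ≤ ⊤)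

theorem lineDerivOp_distribution_comm (v w : E) (T : 𝓓'(Ω, F)) :
    ∂_{v} (∂_{w} T) = ∂_{w} (∂_{v} T) := by
  ext f
  simp only [Distribution.lineDerivOp_apply_apply, lineDerivOp_neg,
    lineDerivOp_testFunction_comm v w]

end LineDeriv

/-! ### Constant coefficient differential operators -/

section DiffOp

variable {n : ℕ}

/-- The derivative `∂ / ∂ x_s` as an element of the algebra of operators on distributions. -/
def partialDerivEnd (s : Fin n) : Module.End ℂ (Distr n) where
  toFun := partialDeriv s
  map_add' S T := lineDerivOp_add (EuclideanSpace.single s (1 : ℝ)) S T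
  map_smul' c T := by
    ext f
    exact (smul_neg c _).symm

theorem partialDerivEnd_commute (s t : Fin n) :
    Commute (partialDerivEnd s) (partialDerivEnd t) :=
  LinearMap.ext fun T => lineDerivOp_distribution_comm
    (EuclideanSpace.single s (1 : ℝ)) (EuclideanSpace.single t (1 : ℝ)) T

/-- The homomorphism `α ↦ ∂₁^{α₁} ⋯ ∂ₙ^{αₙ}` from exponents to operators on distributions. -/
def multiDerivHom : Multiplicative (Fin n →₀ ℕ) →* Module.End ℂ (Distr n) where
  toFun α := ((List.finRange n).map fun s => partialDerivEnd s ^ α.toAdd s).prod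
  map_one' := List.prod_eq_one (by simp)
  map_mul' α β := prod_map_pow_add_of_commute partialDerivEnd_commute α.toAdd β.toAdd _

theorem multiDerivHom_ofAdd_apply (α : Fin n →₀ ℕ) (T : Distr n) :
    multiDerivHom (.ofAdd α) T = multiDeriv α T := by
  change ((List.finRange n).map fun s => partialDerivEnd s ^ α s).prod T = _
  rw [multiDeriv]
  induction List.finRange n with
  | nil => rfl
  | cons s l ih =>
    rw [List.map_cons, List.prod_cons, Module.End.mul_apply, ih, Module.End.pow_apply]
    rfl

theorem multiDerivHom_single (s : Fin n) :
    multiDerivHom (.ofAdd (Finsupp.single s 1)) = partialDerivEnd s := by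
  refine (List.prod_map_eq_pow_single s _ fun t hts _ => ?_).trans ?_
  · simp [Finsupp.single_eq_of_ne hts]
  · simp [List.count_eq_one_of_mem (List.nodup_finRange n) (List.mem_finRange s)]

/-- The algebra homomorphism `p ↦ p(∂)` from polynomials to operators on distributions. -/
def diffOp : MvPolynomial (Fin n) ℂ →ₐ[ℂ] Module.End ℂ (Distr n) :=
  AddMonoidAlgebra.lift ℂ (Module.End ℂ (Distr n)) (Fin n →₀ ℕ) multiDerivHom

theorem diffOp_apply (p : MvPolynomial (Fin n) ℂ) (T : Distr n) : diffOp p T = polyAct p T := by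
  rw [diffOp, AddMonoidAlgebra.lift_apply, Finsupp.sum, LinearMap.sum_apply]
  simp only [LinearMap.smul_apply, multiDerivHom_ofAdd_apply]
  rfl

theorem diffOp_X (s : Fin n) : diffOp (MvPolynomial.X s) = partialDerivEnd s := by
  rw [diffOp, MvPolynomial.X, MvPolynomial.monomial]
  simp [multiDerivHom_single]

theorem diffOp_C (c : ℂ) : diffOp (MvPolynomial.C c) = c • (1 : Module.End ℂ (Distr n)) := by
  rw [← MvPolynomial.algebraMap_eq, AlgHom.commutes, Algebra.algebraMap_eq_smul_one]

theorem diffOp_apply_of_partialDeriv_eq_smul {T : Distr n} {w : Fin n → ℂ}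
    (hT : ∀ s, partialDeriv s T = w s • T) (p : MvPolynomial (Fin n) ℂ) :
    diffOp p T = MvPolynomial.eval w p • T := by
  induction p using MvPolynomial.induction_on with
  | C c => simp
  | add p q hp hq =>
    rw [map_add, LinearMap.add_apply, hp, hq, map_add]
    exact (add_smul _ _ T).symm
  | mul_X p s hp =>
    have hs : diffOp (MvPolynomial.X s) T = w s • T := by rw [diffOp_X]; exact hT s
    rw [map_mul, Module.End.mul_apply, hs, map_smul, hp, smul_smul, map_mul,
      MvPolynomial.eval_X, mul_comm]

/-- The linear form `⟨v, ·⟩` as a polynomial, that is, the symbol of the derivative along `v`. -/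
def linearForm (v : Rn n) : MvPolynomial (Fin n) ℂ :=
  ∑ i, MvPolynomial.C (v i : ℂ) * MvPolynomial.X i

theorem eval_linearForm (v z : Rn n) :
    MvPolynomial.eval (fun i => (z i : ℂ)) (linearForm v) = (inner ℝ v z : ℝ) := by
  simp [linearForm, PiLp.inner_apply, mul_comm]

theorem diffOp_linearForm_apply (v : Rn n) (T : Distr n) : diffOp (linearForm v) T = ∂_{v} T := by
  have hv : v = ∑ i, v i • EuclideanSpace.single i (1 : ℝ) := by
    simpa using ((EuclideanSpace.basisFun (Fin n) ℝ).sum_repr v).symm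
  conv_rhs => rw [hv]
  rw [lineDerivOp_left_sum, linearForm, map_sum, LinearMap.sum_apply]
  refine Finset.sum_congr rfl fun i _ => ?_
  rw [map_mul, diffOp_C, diffOp_X, lineDerivOp_left_smul, smul_mul_assoc, one_mul,
    LinearMap.smul_apply]
  rfl

end DiffOp

/-! ### Derivatives of fibre integrals -/

section FiberIntegral

theorem integral_fderiv_apply_eq_zero {V F : Type*} [NormedAddCommGroup V] [NormedSpace ℝ V]
    [FiniteDimensional ℝ V] [MeasurableSpace V] [BorelSpace V] (μ : Measure V)
    [μ.IsAddHaarMeasure] [NormedAddCommGroup F] [NormedSpace ℝ F] {g : V → F}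
    (hg : ContDiff ℝ 1 g) (hgs : HasCompactSupport g) (v : V) :
    ∫ x, fderiv ℝ g x v ∂μ = 0 := by
  have hd : Continuous fun x => fderiv ℝ g x v :=
    (hg.continuous_fderiv (by simp)).clm_apply continuous_const
  have hds : HasCompactSupport fun x => fderiv ℝ g x v := hgs.fderiv_apply (𝕜 := ℝ) v
  have hparts := integral_smul_fderiv_eq_neg_fderiv_smul_of_integrable (𝕜 := ℝ) (μ := μ)
    (f := fun _ => (1 : ℝ)) (g := g) (v := v) (by simp)
    (by simpa using hd.integrable_of_hasCompactSupport hds)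
    (by simpa using hg.continuous.integrable_of_hasCompactSupport hgs)
    (fun _ _ => differentiableAt_const _)
    (fun x _ => hg.differentiable (by simp) x)
  simpa using hparts

theorem hasCompactSupport_fiber {E F G N : Type*} [NormedAddCommGroup E] [NormedSpace ℝ E] [Zero F]
    [NormedAddCommGroup G] [NormedSpace ℝ G] [NormedAddCommGroup N] [NormedSpace ℝ N]
    {s : G →L[ℝ] E} {i : N →L[ℝ] E} {K : Set E} {k : Set N} {f : E → F} (hk : IsCompact k)
    (hKk : ∀ y w, s y + i w ∈ K → w ∈ k) (hfK : tsupport f ⊆ K) (y : G) :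
    HasCompactSupport fun w => f (s y + i w) := by
  refine HasCompactSupport.intro hk fun w hw => ?_
  by_contra h
  exact hw (hKk y w (hfK (subset_tsupport f h)))

variable {E F G N : Type} [NormedAddCommGroup E] [NormedSpace ℝ E] [NormedAddCommGroup F]
  [NormedSpace ℝ F] [NormedAddCommGroup G] [NormedSpace ℝ G] [NormedAddCommGroup N]
  [NormedSpace ℝ N] [MeasurableSpace N] [BorelSpace N] {s : G →L[ℝ] E} {i : N →L[ℝ] E}
  {μ : Measure N} {K : Set E} {k : Set N} {f : E → F}

theorem fiberIntegral_fderiv_apply_section [IsFiniteMeasureOnCompacts μ]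
    [SecondCountableTopology N] (hK : IsCompact K) (hk : IsCompact k)
    (hKk : ∀ y w, s y + i w ∈ K → w ∈ k) (hf : ContDiff ℝ 1 f) (hfK : tsupport f ⊆ K) (v y : G) :
    fiberIntegral s i μ (fun x => fderiv ℝ f x (s v)) y =
      fderiv ℝ (fiberIntegral s i μ f) y v := by
  have hint : Integrable (fun w => (fderiv ℝ f (s y + i w)).comp s) μ :=
    fiberIntegral_integrable (f := fun x => (fderiv ℝ f x).comp s) hk hKk
      ((hf.continuous_fderiv (by simp)).clm_comp continuous_const)
      (tsupport_fderiv_comp_subset hfK) y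
  rw [(fiberIntegral_hasFDerivAt hK hk hKk hf hfK y).fderiv, fiberIntegral, fiberIntegral,
    ContinuousLinearMap.integral_apply hint]
  rfl

theorem fiberIntegral_fderiv_apply_fiber [FiniteDimensional ℝ N] [μ.IsAddHaarMeasure]
    (hk : IsCompact k) (hKk : ∀ y w, s y + i w ∈ K → w ∈ k) (hf : ContDiff ℝ 1 f)
    (hfK : tsupport f ⊆ K) (w : N) (y : G) :
    fiberIntegral s i μ (fun x => fderiv ℝ f x (i w)) y = 0 := by
  have hfiber : ContDiff ℝ 1 fun w => f (s y + i w) := by fun_prop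
  refine Eq.trans (integral_congr_ae (.of_forall fun w' => ?_))
    (integral_fderiv_apply_eq_zero μ hfiber (hasCompactSupport_fiber hk hKk hfK y) w)
  have hcomp : HasFDerivAt (fun w => f (s y + i w)) ((fderiv ℝ f (s y + i w')).comp i) w' :=
    (hf.differentiable (by simp) _).hasFDerivAt.comp w' (i.hasFDerivAt.const_add _)
  exact congr($(hcomp.fderiv.symm) w)

theorem fiberIntegral_fderiv_apply [FiniteDimensional ℝ N] [μ.IsAddHaarMeasure]
    (hK : IsCompact K) (hk : IsCompact k) (hKk : ∀ y w, s y + i w ∈ K → w ∈ k)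
    (hf : ContDiff ℝ 1 f) (hfK : tsupport f ⊆ K) (v : G) (w : N) (y : G) :
    fiberIntegral s i μ (fun x => fderiv ℝ f x (s v + i w)) y =
      fderiv ℝ (fiberIntegral s i μ f) y v := by
  have : ProperSpace N := FiniteDimensional.proper_real N
  have hint (a : E) : Integrable (fun w => fderiv ℝ f (s y + i w) a) μ :=
    fiberIntegral_integrable (f := fun x => fderiv ℝ f x a) hk hKk
      ((hf.continuous_fderiv (by simp)).clm_apply continuous_const)
      ((tsupport_fderiv_apply_subset ℝ a).trans hfK) y
  calc fiberIntegral s i μ (fun x => fderiv ℝ f x (s v + i w)) y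
      = fiberIntegral s i μ (fun x => fderiv ℝ f x (s v)) y
        + fiberIntegral s i μ (fun x => fderiv ℝ f x (i w)) y := by
        simp only [fiberIntegral, map_add]
        exact integral_add (hint _) (hint _)
    _ = fderiv ℝ (fiberIntegral s i μ f) y v := by
        rw [fiberIntegral_fderiv_apply_section hK hk hKk hf hfK,
          fiberIntegral_fderiv_apply_fiber hk hKk hf hfK, add_zero]

end FiberIntegral

/-! ### The chain rule for `δ(L x)` -/

section ChainRule

variable {m n : ℕ} {L : Matrix (Fin m) (Fin n) ℝ}

theorem pushFun_fderiv_apply (hL : L.rank = m) {f : Rn n → ℝ} (hf : ContDiff ℝ 1 f)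
    (hfs : HasCompactSupport f) (v : Rn n) (y : Rn m) :
    pushFun L (fun x => fderiv ℝ f x v) y = fderiv ℝ (pushFun L f) y (linMap L v) := by
  obtain ⟨k, hk, hKk⟩ := exists_compact_fiber hL hfs
  have hker : v - rightInv L (linMap L v) ∈ kerOf L := by
    change linMap L _ = 0
    rw [map_sub, linMap_rightInv hL, sub_self]
  have hv : v = rightInv L (linMap L v) + (kerOf L).subtypeL ⟨_, hker⟩ := by simp
  have hdiff : DifferentiableAt ℝ
      (fiberIntegral (rightInv L) (kerOf L).subtypeL volume f) y :=
    (fiberIntegral_hasFDerivAt hfs hk hKk hf subset_rfl y).differentiableAt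
  have hderiv := fiberIntegral_fderiv_apply (μ := volume) hfs hk hKk hf subset_rfl
    (linMap L v) ⟨_, hker⟩ y
  rw [← hv] at hderiv
  rw [pushFun, hderiv]
  exact congr($((hdiff.hasFDerivAt.const_mul (√(L * Lᵀ).det)⁻¹).fderiv.symm) (linMap L v))

theorem pushTest_lineDerivOp (hL : L.rank = m) (v : Rn n) (f : Test n) :
    pushTest L hL (∂_{v} f) = ∂_{linMap L v} (pushTest L hL f) := by
  ext y
  rw [pushTest_apply, lineDerivOp_testFunction_apply, funext (lineDerivOp_testFunction_apply v f)]
  exact pushFun_fderiv_apply hL (f.contDiff.of_le (by exact_mod_cast le_top))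
    f.hasCompactSupport v y

theorem lineDerivOp_pullback (hL : L.rank = m) (v : Rn n) (δ : Distr m) :
    ∂_{v} (pullback L hL δ) = pullback L hL (∂_{linMap L v} δ) := by
  ext f
  simp only [Distribution.lineDerivOp_apply_apply, pullback_apply, map_neg,
    pushTest_lineDerivOp]

/-- The substitution `p(y) ↦ p(Lᵀ y)`, which sends `∂_s` to the symbol of the derivative along the
`s`-th column of `L`. -/
def substTranspose (L : Matrix (Fin m) (Fin n) ℝ) :
    MvPolynomial (Fin n) ℂ →ₐ[ℂ] MvPolynomial (Fin m) ℂ :=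
  MvPolynomial.aeval fun s => linearForm (linMap L (EuclideanSpace.single s 1))

theorem eval_substTranspose (L : Matrix (Fin m) (Fin n) ℝ) (p : MvPolynomial (Fin n) ℂ)
    (z : Rn m) :
    MvPolynomial.eval (fun i => (z i : ℂ)) (substTranspose L p) =
      MvPolynomial.eval (fun s => (linMap Lᵀ z s : ℂ)) p := by
  induction p using MvPolynomial.induction_on with
  | C c => simp [substTranspose]
  | add p q hp hq => rw [map_add, map_add, map_add, hp, hq]
  | mul_X p s hp =>
    rw [map_mul, map_mul, map_mul, hp, substTranspose, MvPolynomial.aeval_X, eval_linearForm,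
      inner_linMap_left, EuclideanSpace.inner_single_left, MvPolynomial.eval_X]
    simp

theorem diffOp_pullback (hL : L.rank = m) (p : MvPolynomial (Fin n) ℂ) (δ : Distr m) :
    diffOp p (pullback L hL δ) = pullback L hL (diffOp (substTranspose L p) δ) := by
  induction p using MvPolynomial.induction_on generalizing δ with
  | C c =>
    rw [← MvPolynomial.algebraMap_eq, AlgHom.commutes, AlgHom.commutes, AlgHom.commutes]
    rfl
  | add p q hp hq =>
    rw [map_add, map_add, map_add, LinearMap.add_apply, hp, hq]
    rfl
  | mul_X p s hp =>
    have hs : diffOp (.X s) (pullback L hL δ) =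
        pullback L hL (diffOp (substTranspose L (.X s)) δ) := by
      rw [substTranspose, MvPolynomial.aeval_X, diffOp_linearForm_apply, ← lineDerivOp_pullback,
        diffOp_X]
      rfl
    rw [map_mul, map_mul, map_mul, Module.End.mul_apply, Module.End.mul_apply, hs, hp]

end ChainRule

/-! ### Exponential distributions -/

section Exponential

variable {m n : ℕ}

/-- The distribution `f ↦ ∫ f g` given by a function `g`; it is zero if `g` is not locally
integrable. -/
def distrOfFun (g : Rn m → ℂ) : Distr m :=
  (TestFunction.integralAgainstBilinCLM (ContinuousLinearMap.lsmul ℝ ℝ) volume g : Test m →L[ℝ] ℂ)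

theorem distrOfFun_apply {g : Rn m → ℂ} (hg : LocallyIntegrable g) (f : Test m) :
    distrOfFun g f = ∫ x, f x • g x :=
  TestFunction.integralAgainstBilinCLM_eq_integral (B := ContinuousLinearMap.lsmul ℝ ℝ)
    (hg.locallyIntegrableOn _)

theorem distrOfFun_const_mul {g : Rn m → ℂ} (hg : LocallyIntegrable g) (c : ℂ) :
    (distrOfFun fun x => c * g x) = c • distrOfFun g := by
  ext f
  calc distrOfFun (fun x => c * g x) f = ∫ x, f x • (c * g x) := distrOfFun_apply (hg.smul c) f
    _ = c * ∫ x, f x • g x := by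
      simp only [Complex.real_smul, mul_left_comm _ c, integral_const_mul]
    _ = (c • distrOfFun g) f := congrArg (c * ·) (distrOfFun_apply hg f).symm

theorem lineDerivOp_distrOfFun {g : Rn m → ℂ} (hg : ContDiff ℝ 1 g) (v : Rn m) :
    ∂_{v} (distrOfFun g) = distrOfFun fun x => fderiv ℝ g x v := by
  have hg' : Continuous fun x => fderiv ℝ g x v :=
    (hg.continuous_fderiv (by simp)).clm_apply continuous_const
  ext f
  have hint {f' : Rn m → ℝ} {h : Rn m → ℂ} (hf : Continuous f') (hfs : HasCompactSupport f')
      (hh : Continuous h) : Integrable fun x => f' x • h x :=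
    (hf.smul hh).integrable_of_hasCompactSupport hfs.smul_right
  have hparts : ∫ x, f x • fderiv ℝ g x v = -∫ x, fderiv ℝ f x v • g x :=
    integral_smul_fderiv_eq_neg_fderiv_smul_of_integrable
      (hint ((f.contDiff.continuous_fderiv (by simp)).clm_apply continuous_const)
        (f.hasCompactSupport.fderiv_apply (𝕜 := ℝ) v) hg.continuous)
      (hint f.continuous f.hasCompactSupport hg')
      (hint f.continuous f.hasCompactSupport hg.continuous)
      (fun x _ => f.contDiff.differentiable (by simp) x)
      (fun x _ => hg.differentiable (by simp) x)
  rw [Distribution.lineDerivOp_apply_apply, map_neg,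
    distrOfFun_apply hg.continuous.locallyIntegrable, distrOfFun_apply hg'.locallyIntegrable,
    hparts]
  simp only [lineDerivOp_testFunction_apply]

theorem pushFun_nonneg (L : Matrix (Fin m) (Fin n) ℝ) {f : Rn n → ℝ} (hf : ∀ x, 0 ≤ f x)
    (y : Rn m) : 0 ≤ pushFun L f y :=
  mul_nonneg (by positivity) (integral_nonneg fun _ => hf _)

theorem pushFun_pos {L : Matrix (Fin m) (Fin n) ℝ} (hL : L.rank = m) {f : Rn n → ℝ}
    (hc : Continuous f) (hfs : HasCompactSupport f) (hf : ∀ x, 0 ≤ f x) {y : Rn m}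
    (hy : f (rightInv L y) ≠ 0) : 0 < pushFun L f y := by
  obtain ⟨k, hk, hKk⟩ := exists_compact_fiber hL hfs
  have hdet := det_mul_transpose_pos (hL.trans (Fintype.card_fin m).symm)
  have hc' : Continuous fun w : kerOf L => f (rightInv L y + (kerOf L).subtypeL w) := by fun_prop
  refine mul_pos (inv_pos.2 (Real.sqrt_pos.2 hdet)) ?_
  exact hc'.integral_pos_of_hasCompactSupport_nonneg_nonzero
    (hasCompactSupport_fiber hk hKk subset_rfl y) (fun _ => hf _) (x := 0) (by simpa using hy)

theorem pullback_distrOfFun_ne_zero {L : Matrix (Fin m) (Fin n) ℝ} (hL : L.rank = m)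
    {g : Rn m → ℝ} (hg : Continuous g) (hpos : ∀ y, 0 < g y) :
    pullback L hL (distrOfFun fun y => (g y : ℂ)) ≠ 0 := by
  let b : ContDiffBump (0 : Rn n) := default
  let f : Test n := ⟨b, b.contDiff, b.hasCompactSupport, fun _ _ => trivial⟩
  have hc : Continuous fun y => pushTest L hL f y * g y := (pushTest L hL f).continuous.mul hg
  have hpush : 0 < pushTest L hL f 0 := by
    refine pushFun_pos hL b.continuous b.hasCompactSupport (fun _ => b.nonneg) ?_
    rw [map_zero]
    exact (b.pos_of_mem_ball (Metric.mem_ball_self b.rOut_pos)).ne'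
  have hint : 0 < ∫ y, pushTest L hL f y * g y :=
    hc.integral_pos_of_hasCompactSupport_nonneg_nonzero
      (pushTest L hL f).hasCompactSupport.mul_right
      (fun y => mul_nonneg (pushFun_nonneg L (fun _ => b.nonneg) y) (hpos y).le)
      (x := 0) (mul_pos hpush (hpos 0)).ne'
  intro hzero
  have hf : pullback L hL (distrOfFun fun y => (g y : ℂ)) f = 0 := by rw [hzero]; rfl
  have hgc : Continuous fun y => (g y : ℂ) := by fun_prop
  rw [pullback_apply, distrOfFun_apply hgc.locallyIntegrable] at hf
  simp only [Complex.real_smul, ← Complex.ofReal_mul, integral_complex_ofReal,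
    Complex.ofReal_eq_zero] at hf
  exact hint.ne' hf

/-- The distribution given by the function `x ↦ exp ⟨z, x⟩`, a joint eigenvector of the partial
derivatives. -/
def expDistr (z : Rn m) : Distr m :=
  distrOfFun fun x => (Real.exp (inner ℝ z x) : ℂ)

theorem hasFDerivAt_ofReal_exp_inner (z x : Rn m) :
    HasFDerivAt (fun x : Rn m => (Real.exp (inner ℝ z x) : ℂ))
      (Complex.ofRealCLM ∘L (Real.exp (inner ℝ z x) • innerSL ℝ z)) x :=
  Complex.ofRealCLM.hasFDerivAt.comp x (innerSL ℝ z).hasFDerivAt.exp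

theorem partialDeriv_expDistr (z : Rn m) (s : Fin m) :
    partialDeriv s (expDistr z) = (z s : ℂ) • expDistr z := by
  have hsmooth : ContDiff ℝ 1 fun x : Rn m => (Real.exp (inner ℝ z x) : ℂ) :=
    Complex.ofRealCLM.contDiff.comp (contDiff_const.inner ℝ contDiff_id).exp
  have hderiv (x : Rn m) : fderiv ℝ (fun x : Rn m => (Real.exp (inner ℝ z x) : ℂ)) x
      (EuclideanSpace.single s 1) = z s * Real.exp (inner ℝ z x) := by
    rw [(hasFDerivAt_ofReal_exp_inner z x).fderiv]
    simp [EuclideanSpace.inner_single_right, mul_comm]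
  calc partialDeriv s (expDistr z)
      = distrOfFun fun x => (z s : ℂ) * Real.exp (inner ℝ z x) := by
        rw [← funext hderiv, ← lineDerivOp_distrOfFun hsmooth]
        rfl
    _ = (z s : ℂ) • expDistr z :=
        distrOfFun_const_mul hsmooth.continuous.locallyIntegrable _

theorem pullback_expDistr_ne_zero {L : Matrix (Fin m) (Fin n) ℝ} (hL : L.rank = m) (z : Rn m) :
    pullback L hL (expDistr z) ≠ 0 :=
  pullback_distrOfFun_ne_zero hL (by fun_prop) fun _ => Real.exp_pos _

end Exponential

/-! ### Characterisation of the wave cone -/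

section WaveConeCharacterisation

variable {m n k l r : ℕ}

theorem forall_diffOp_pullback_eq_zero_iff (hm : 0 < m) {L : Matrix (Fin m) (Fin n) ℝ}
    (hL : L.rank = m) (p : MvPolynomial (Fin n) ℂ) :
    (∀ δ : Distr m, diffOp p (pullback L hL δ) = 0) ↔
      ∀ y ∈ rowSpace L, y ≠ 0 → MvPolynomial.eval (fun s => (y s : ℂ)) p = 0 := by
  simp only [diffOp_pullback]
  constructor
  · rintro hsol _ ⟨z, rfl⟩ -
    have hexp := hsol (expDistr z)
    rw [diffOp_apply_of_partialDeriv_eq_smul (partialDeriv_expDistr z), eval_substTranspose]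
      at hexp
    exact (smul_eq_zero.1 hexp).resolve_right (pullback_expDistr_ne_zero hL z)
  · intro hcone δ
    have : Nonempty (Fin m) := ⟨⟨0, hm⟩⟩
    have hsubst : substTranspose L p = 0 := by
      refine eq_zero_of_eval_algebraMap_eq_zero (R := ℝ) fun z hz => ?_
      have hz' : linMap Lᵀ (WithLp.toLp 2 z) ≠ 0 := by
        rw [map_ne_zero_iff _ (linMap_transpose_injective hL)]
        exact fun h => hz congr(WithLp.ofLp $h)
      exact (eval_substTranspose L p (WithLp.toLp 2 z)).trans (hcone _ ⟨_, rfl⟩ hz')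
    rw [hsubst, map_zero]
    rfl

theorem isSolution_smul_iff (A : Matrix (Fin l) (Fin k) (MvPolynomial (Fin n) ℂ))
    (u : Fin k → ℂ) (T : Distr n) :
    IsSolution A (fun j => u j • T) ↔
      ∀ i, diffOp ((A *ᵥ fun j => MvPolynomial.C (u j)) i) T = 0 := by
  refine forall_congr' fun i => ?_
  rw [Matrix.mulVec, dotProduct, map_sum, LinearMap.sum_apply]
  simp only [map_mul, diffOp_C, Module.End.mul_apply, LinearMap.smul_apply, Module.End.one_apply,
    diffOp_apply]

theorem evalAt_mulVec (A : Matrix (Fin l) (Fin k) (MvPolynomial (Fin n) ℂ)) (u : Fin k → ℂ)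
    (y : Rn n) (i : Fin l) :
    (evalAt A y *ᵥ u) i =
      MvPolynomial.eval (fun s => (y s : ℂ)) ((A *ᵥ fun j => MvPolynomial.C (u j)) i) := by
  rw [RingHom.map_mulVec]
  simp [evalAt, Function.comp_def]

theorem forall_isSolution_pullback_iff (hm : 0 < m)
    (A : Matrix (Fin l) (Fin k) (MvPolynomial (Fin n) ℂ)) (u : Fin k → ℂ)
    {L : Matrix (Fin m) (Fin n) ℝ} (hL : L.rank = m) :
    (∀ δ : Distr m, IsSolution A (fun j => u j • pullback L hL δ)) ↔
      ∀ y ∈ rowSpace L, y ≠ 0 → evalAt A y *ᵥ u = 0 := by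
  simp only [isSolution_smul_iff, funext_iff, evalAt_mulVec, Pi.zero_apply]
  rw [forall_comm]
  simp only [forall_diffOp_pullback_eq_zero_iff hm]
  exact ⟨fun h y hy hy0 i => h i y hy hy0, fun h i y hy hy0 => h y hy hy0 i⟩

theorem mem_realWaveCone_iff (A : Matrix (Fin l) (Fin k) (MvPolynomial (Fin n) ℂ))
    (u : Fin k → ℂ) :
    u ∈ realWaveCone A r ↔ ∃ L : Matrix (Fin (n - r)) (Fin n) ℝ, L.rank = n - r ∧
      ∀ y ∈ rowSpace L, y ≠ 0 → evalAt A y *ᵥ u = 0 := by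
  simp only [realWaveCone, Set.mem_iUnion, Set.mem_iInter, and_imp, exists_prop, Set.mem_ofPred_eq]
  constructor
  · rintro ⟨π, hπ, hu⟩
    obtain ⟨L, rfl⟩ := exists_rowSpace_eq hπ
    exact ⟨L, finrank_rowSpace L ▸ hπ, hu⟩
  · rintro ⟨L, hL, hu⟩
    exact ⟨rowSpace L, (finrank_rowSpace L).trans hL, hu⟩

end WaveConeCharacterisation

end WaveCone

end

theorem mainTheorem5_general (n k l r : ℕ) (hr : r < n)
    (A : Matrix (Fin l) (Fin k) (MvPolynomial (Fin n) ℂ)) (u : Fin k → ℂ) :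
    u ∈ WaveCone.realWaveCone A r ↔
      ∃ (L : Matrix (Fin (n - r)) (Fin n) ℝ) (hL : L.rank = n - r),
        ∀ δ : WaveCone.Distr (n - r),
          WaveCone.IsSolution A (fun j => u j • WaveCone.pullback L hL δ) := by
  simp only [WaveCone.mem_realWaveCone_iff, exists_prop,
    WaveCone.forall_isSolution_pullback_iff (Nat.sub_pos_of_lt hr)]

theorem mainTheorem5 (n k l d r : ℕ) (hr : r < n)
    (A : Matrix (Fin l) (Fin k) (MvPolynomial (Fin n) ℂ))
    (hA : ∀ i j, (A i j).IsHomogeneous d) (u : Fin k → ℂ) :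
    u ∈ WaveCone.realWaveCone A r ↔
      ∃ (L : Matrix (Fin (n - r)) (Fin n) ℝ) (hL : L.rank = n - r),
        ∀ δ : WaveCone.Distr (n - r),
          WaveCone.IsSolution A (fun j => u j • WaveCone.pullback L hL δ) :=
  mainTheorem5_general n k l r hr A u
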